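/- Let $\mathbf{Met}$ be the category of extended metric spaces (distance $\infty$ is allowed) and nonexpanding maps, with tensor product the cartesian product with the addition metric $d((x,y),(x',y'))=d(x,x')+d(y,y')$. A metric-enriched category is a category with an extended metric on each hom-set such that $d(g\cdot f,g'\cdot f')\le d(f,f')+d(g,g')$; a functor between such categories is enriched if it is locally nonexpanding ($d(Ff,Fg)\le d(f,g)$), and an equivalence of metric-enriched categories consists of enriched functors. Let $\mathbf{Mon}(\mathbf{Met})$ be the category of monoids in $(\mathbf{Met},\otimes,1)$, that is, of extended metric spaces with a monoid structure satisfying $d(xy,x'y')\le d(x,x')+d(y,y')$, and of nonexpanding monoid homomorphisms, with the supremum metric on hom-sets. For a set $A$ let $A^*$ be the free monoid on $A$ with the discrete metric (distinct elements have distance $\infty$). For a finitary signature $\Sigma$, a quantitative $\Sigma$-algebra is an extended metric space with operations $A^n\to A$ that are nonexpanding with respect to the maximum metric; morphisms are the nonexpanding homomorphisms, with the supremum metric. A variety is a full subcategory of quantitative $\Sigma$-algebras specified by a set of quantitative equations $t=_\varepsilon t'$ ($t,t'$ terms over a finite set of variables, $\varepsilon\ge 0$ real), where $A$ satisfies $t=_\varepsilon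 t'$ if the values of $t$ and $t'$ have distance at most $\varepsilon$ under every interpretation of the variables in $A$. In a metric-enriched category $\mathcal K$, a basic diagram on $X$ is a functor $\varepsilon\mapsto D\varepsilon$ from the ordered set of real numbers $\varepsilon\ge 0$ to $\mathcal K$ with two cocones $l_\varepsilon,r_\varepsilon\colon D\varepsilon\to X$. A morphism $f\colon X\to C$ is its colimit map if (i) $d(f\cdot l_\varepsilon,f\cdot r_\varepsilon)\le\varepsilon$ for all $\varepsilon$, (ii) $d(u_1,u_2)=d(u_1\cdot f,u_2\cdot f)$ for all parallel pairs $u_1,u_2$ with domain $C$, and (iii) every $f'\colon X\to C'$ satisfying (i) factorizes through $f$. A subregular epimorphism is a colimit map of some basic diagram. An object $G$ is a subregular projective if every morphism $G\to Y$ factorizes through each subregular epimorphism $X\to Y$. It is abstractly finite if it has copowers and every morphism from $G$ to a copower $\coprod_M G$ factorizes through a finite subcopower. It is a subregular generator if its hom-functor $\mathcal K(G,-)\colon\mathcal K\to\mathbf{Met}$ has an enriched left adjoint $-\otimes G$ and all evaluation morphisms (counit components) $\mathcal K(G,X)\otimes G\to X$ are subregular epimorphisms. A subvarietal generator is an abstractly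 finite, subregularly projective subregular generator. Then the following hold. 1. $\mathbf{Mon}(\mathbf{Met})$ is not equivalent, as a metric-enriched category, to any variety of quantitative algebras. 2. $\mathbf{Mon}(\mathbf{Met})$ has no subvarietal generator. 3. Every subregular projective of $\mathbf{Mon}(\mathbf{Met})$ is isomorphic to $A^*$ for some set $A$. 4. For every nonempty set $A$, the hom-functor $\mathbf{Mon}(\mathbf{Met})(A^*,-)\colon\mathbf{Mon}(\mathbf{Met})\to\mathbf{Met}$ has a left adjoint (as an ordinary functor), but no left adjoint of it is enriched. -/

import Mathlib

open CategoryTheory CategoryTheory.Limits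
open scoped ENNReal NNReal

universe w v u

namespace QuantAlg

noncomputable section

/-! ## Metric-enriched categories -/

/-- A metric-enriched category: every hom-set carries an extended metric, and composition is
nonexpanding with respect to the addition metric. -/
class MetricEnriched (C : Type w) [Category.{v} C] where
  homMetric : ∀ X Y : C, EMetricSpace (X ⟶ Y)
  edist_comp_le : ∀ {X Y Z : C} (f f' : X ⟶ Y) (g g' : Y ⟶ Z),
    edist (f ≫ g) (f' ≫ g') ≤ edist f f' + edist g g'

attribute [instance, reducible] MetricEnriched.homMetric

/-- A functor between metric-enriched categories is enriched if it is locally nonexpanding. -/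
def IsEnrichedFunctor {C : Type*} [Category C] [MetricEnriched C] {D : Type*} [Category D]
    [MetricEnriched D] (F : C ⥤ D) : Prop :=
  ∀ ⦃X Y : C⦄ (f g : X ⟶ Y), edist (F.map f) (F.map g) ≤ edist f g

/-- Equivalence of metric-enriched categories. -/
def EnrichedEquivalent (C : Type*) [Category C] [MetricEnriched C] (D : Type*) [Category D]
    [MetricEnriched D] : Prop :=
  ∃ e : C ≌ D, IsEnrichedFunctor e.functor ∧ IsEnrichedFunctor e.inverse

/-- The supremum metric on a type `H` of functions from `X` to `Y`. -/
abbrev supMetric {H X Y : Type*} [EMetricSpace Y] (coe : H → X → Y)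
    (inj : Function.Injective coe) : EMetricSpace H where
  edist f g := ⨆ x, edist (coe f x) (coe g x)
  edist_self f := by simp
  edist_comm f g := by simp only [edist_comm]
  edist_triangle f g h := iSup_le fun x =>
    (edist_triangle _ (coe g x) _).trans (add_le_add
      (le_iSup (fun x => edist (coe f x) (coe g x)) x)
      (le_iSup (fun x => edist (coe g x) (coe h x)) x))
  eq_of_edist_eq_zero {f g} h := inj <| funext fun x =>
    edist_le_zero.mp <| h ▸ le_iSup (fun x => edist (coe f x) (coe g x)) x

/-- The discrete metric: distinct points have distance `∞`. -/
abbrev discreteMetric (X : Type*) : EMetricSpace X where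
  edist x y := ⨆ _ : x ≠ y, ⊤
  edist_self x := by simp
  edist_comm x y := by simp only [ne_comm]
  edist_triangle x y z := by
    by_cases h : x = y
    · subst h; simp
    · simp [h]
  eq_of_edist_eq_zero {x y} h := by
    by_contra hne
    simp [hne] at h

/-! ## The category of extended metric spaces and nonexpanding maps -/

/-- Extended metric spaces. -/
structure Met : Type (u + 1) where
  carrier : Type u
  [metric : EMetricSpace carrier]

namespace Met

instance : CoeSort Met.{u} (Type u) := ⟨Met.carrier⟩

instance (X : Met.{u}) : EMetricSpace X := X.metric

/-- Nonexpanding maps. -/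
@[ext]
structure Hom (X Y : Met.{u}) : Type u where
  toFun : X → Y
  nonexpanding : ∀ x x' : X, edist (toFun x) (toFun x') ≤ edist x x'

instance : Category Met.{u} where
  Hom := Hom
  id X := ⟨fun x => x, fun _ _ => le_rfl⟩
  comp f g := ⟨fun x => g.toFun (f.toFun x),
    fun _ _ => (g.nonexpanding _ _).trans (f.nonexpanding _ _)⟩

instance : MetricEnriched Met.{u} where
  homMetric X Y := supMetric (fun f : Hom X Y => f.toFun) fun _ _ h => Hom.ext h
  edist_comp_le f f' g g' := iSup_le fun x =>
    (edist_triangle _ (g.toFun (f'.toFun x)) _).trans <| add_le_add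
      ((g.nonexpanding _ _).trans
        (le_iSup (fun x => edist (f.toFun x) (f'.toFun x)) x))
      (le_iSup (fun y => edist (g.toFun y) (g'.toFun y)) (f'.toFun x))

end Met

/-! ## Notions in a metric-enriched category -/

section Enriched

variable {C : Type w} [Category.{v} C] [MetricEnriched C]

/-- The hom-functor of an object, with values in extended metric spaces. -/
def homFunctor (K : C) : C ⥤ Met.{v} where
  obj X := ⟨K ⟶ X⟩
  map f := ⟨fun g => g ≫ f, fun g g' =>
    (MetricEnriched.edist_comp_le g g' f f).trans (by simp)⟩
  map_id X := Met.Hom.ext (funext fun g => Category.comp_id g)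
  map_comp f f' := Met.Hom.ext (funext fun g => (Category.assoc g f f').symm)

/-- `p` is a quotient: precomposition with `p` preserves distances. -/
def IsQuotient {P X : C} (p : P ⟶ X) : Prop :=
  ∀ ⦃U : C⦄ (u₁ u₂ : X ⟶ U), edist u₁ u₂ = edist (p ≫ u₁) (p ≫ u₂)

/-- A basic diagram with `D a = X`: a diagram indexed by the chain of all real numbers `ε ≥ 0`
together with two cocones `l`, `r` with codomain `X`. -/
structure BasicDiagram (X : C) where
  D : ℝ≥0 ⥤ C
  l : D ⟶ (Functor.const ℝ≥0).obj X
  r : D ⟶ (Functor.const ℝ≥0).obj X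

/-- The compatibility condition `d(f · D l_ε, f · D r_ε) ≤ ε` for all `ε`. -/
def BasicDiagram.Compatible {X : C} (D : BasicDiagram X) {Y : C} (f : X ⟶ Y) : Prop :=
  ∀ ε : ℝ≥0, edist (D.l.app ε ≫ f) (D.r.app ε ≫ f) ≤ (ε : ℝ≥0∞)

/-- `f` is the colimit map of the basic diagram: the universal compatible morphism. -/
structure BasicDiagram.IsColimitMap {X : C} (D : BasicDiagram X) {Y : C} (f : X ⟶ Y) :
    Prop where
  compatible : D.Compatible f
  quotient : IsQuotient f
  factors : ∀ ⦃Z : C⦄ (f' : X ⟶ Z), D.Compatible f' → ∃ h : Y ⟶ Z, f ≫ h = f'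

/-- Subregular epimorphisms: colimit maps of basic diagrams. -/
def IsSubregularEpi {X Y : C} (f : X ⟶ Y) : Prop :=
  ∃ D : BasicDiagram X, D.IsColimitMap f

/-- Subregular projectives. -/
def IsSubregularProjective (K : C) : Prop :=
  ∀ ⦃X Y : C⦄ (e : X ⟶ Y), IsSubregularEpi e → ∀ g : K ⟶ Y, ∃ h : K ⟶ X, h ≫ e = g

/-- Abstractly finite objects: objects with copowers such that every morphism into a copower of
the object factorizes through a finite subcopower. -/
structure IsAbstractlyFinite {C : Type w} [Category.{v} C] (X : C) : Prop where
  copowers : ∀ M : Type v, HasCoproduct fun _ : M => X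
  factors : ∀ (M : Type v) (f : X ⟶ ∐ fun _ : M => X), ∃ (s : Finset M)
    (g : X ⟶ ∐ fun _ : s => X),
    g ≫ Sigma.desc (fun i : s => Sigma.ι (fun _ : M => X) i.1) = f

/-- `L` together with `adj` exhibits the tensors `M ⊗ K = L.obj M`: it is an enriched left adjoint
of the hom-functor of `K`. The evaluation morphism `C(K, X) ⊗ K ⟶ X` is the counit at `X`. An
object is a subregular generator if it has tensors and all evaluation morphisms are
subregular epimorphisms. -/
def IsSubregularGenerator (K : C) : Prop :=
  ∃ (L : Met.{v} ⥤ C) (adj : L ⊣ homFunctor K), IsEnrichedFunctor L ∧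
    ∀ X : C, IsSubregularEpi (adj.counit.app X)

/-- Subvarietal generators: abstractly finite, subregularly projective subregular generators. -/
structure IsSubvarietalGenerator (G : C) : Prop where
  generator : IsSubregularGenerator G
  abstractlyFinite : IsAbstractlyFinite G
  projective : IsSubregularProjective G

end Enriched

/-! ## Quantitative algebras and their varieties -/

/-- A finitary signature: a set of `n`-ary operation symbols for every `n`. -/
def Signature : Type (u + 1) := ℕ → Type u

/-- A quantitative algebra: operations are nonexpanding with respect to the maximum metric
(the metric of the function space `Fin n → carrier`). -/
structure Algebra (S : Signature.{u}) : Type (u + 1) where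
  carrier : Type u
  [metric : EMetricSpace carrier]
  op : ∀ {n : ℕ}, S n → (Fin n → carrier) → carrier
  op_nonexpanding : ∀ {n : ℕ} (σ : S n) (x y : Fin n → carrier),
    edist (op σ x) (op σ y) ≤ edist x y

namespace Algebra

variable {S : Signature.{u}}

instance : CoeSort (Algebra.{u} S) (Type u) := ⟨Algebra.carrier⟩

instance (A : Algebra.{u} S) : EMetricSpace A := A.metric

/-- Nonexpanding homomorphisms. -/
@[ext]
structure Hom (A B : Algebra.{u} S) : Type u where
  toFun : A → B
  map_op : ∀ {n : ℕ} (σ : S n) (x : Fin n → A), toFun (A.op σ x) = B.op σ fun i => toFun (x i)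
  nonexpanding : ∀ x x' : A, edist (toFun x) (toFun x') ≤ edist x x'

instance : Category (Algebra.{u} S) where
  Hom := Hom
  id A := ⟨fun x => x, fun _ _ => rfl, fun _ _ => le_rfl⟩
  comp f g := ⟨fun x => g.toFun (f.toFun x), fun σ x => by rw [f.map_op, g.map_op],
    fun _ _ => (g.nonexpanding _ _).trans (f.nonexpanding _ _)⟩

instance : MetricEnriched (Algebra.{u} S) where
  homMetric X Y := supMetric (fun f : Hom X Y => f.toFun) fun _ _ h => Hom.ext h
  edist_comp_le f f' g g' := iSup_le fun x =>
    (edist_triangle _ (g.toFun (f'.toFun x)) _).trans <| add_le_add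
      ((g.nonexpanding _ _).trans
        (le_iSup (fun x => edist (f.toFun x) (f'.toFun x)) x))
      (le_iSup (fun y => edist (g.toFun y) (g'.toFun y)) (f'.toFun x))

end Algebra

/-- Terms over a signature with variables in `X`. -/
inductive Term (S : Signature.{u}) (X : Type v) : Type (max u v)
  | var (x : X) : Term S X
  | app {n : ℕ} (σ : S n) (t : Fin n → Term S X) : Term S X

/-- The value of a term under an interpretation of its variables. -/
def Term.eval {S : Signature.{u}} {X : Type v} (A : Algebra.{u} S) (f : X → A) : Term S X → A
  | .var x => f x
  | .app σ t => A.op σ fun i => (t i).eval A f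

/-- A quantitative equation `lhs =_ε rhs` over a finite set of variables. -/
structure QuantEquation (S : Signature.{u}) : Type u where
  numVars : ℕ
  lhs : Term S (Fin numVars)
  rhs : Term S (Fin numVars)
  ε : ℝ≥0

/-- Satisfaction of a quantitative equation. -/
def Algebra.Satisfies {S : Signature.{u}} (A : Algebra.{u} S) (e : QuantEquation S) : Prop :=
  ∀ f : Fin e.numVars → A, edist (e.lhs.eval A f) (e.rhs.eval A f) ≤ (e.ε : ℝ≥0∞)

/-- The variety of quantitative algebras specified by a set of quantitative equations. -/
abbrev Variety (S : Signature.{u}) (E : Set (QuantEquation S)) : Type (u + 1) :=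
  ObjectProperty.FullSubcategory fun A : Algebra.{u} S => ∀ e ∈ E, A.Satisfies e

/-- A full subcategory inherits the metrics of the hom-sets. -/
instance {C : Type w} [Category.{v} C] [MetricEnriched C] (P : ObjectProperty C) :
    MetricEnriched P.FullSubcategory where
  homMetric X Y := EMetricSpace.induced (fun f : X ⟶ Y => f.hom)
    (fun _ _ h => ObjectProperty.hom_ext _ h) inferInstance
  edist_comp_le f f' g g' := MetricEnriched.edist_comp_le f.hom f'.hom g.hom g'.hom

/-! ## Monoids in the category of metric spaces -/

/-- Monoids in the monoidal category of extended metric spaces with the addition metric as tensor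
product: the multiplication is nonexpanding with respect to the addition metric. -/
structure MonMet : Type (u + 1) where
  carrier : Type u
  [metric : EMetricSpace carrier]
  [monoid : Monoid carrier]
  edist_mul_le : ∀ x x' y y' : carrier, edist (x * y) (x' * y') ≤ edist x x' + edist y y'

namespace MonMet

instance : CoeSort MonMet.{u} (Type u) := ⟨MonMet.carrier⟩

instance (M : MonMet.{u}) : EMetricSpace M := M.metric

instance (M : MonMet.{u}) : Monoid M := M.monoid

/-- Nonexpanding monoid homomorphisms. -/
structure Hom (M N : MonMet.{u}) : Type u where
  toHom : M →* N
  nonexpanding : ∀ x x' : M, edist (toHom x) (toHom x') ≤ edist x x'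

theorem Hom.ext_fun {M N : MonMet.{u}} {f g : Hom M N}
    (h : (fun x => f.toHom x) = fun x => g.toHom x) : f = g := by
  obtain ⟨f, hf⟩ := f
  obtain ⟨g, hg⟩ := g
  have : f = g := MonoidHom.ext (congrFun h)
  subst this
  rfl

instance : Category MonMet.{u} where
  Hom := Hom
  id M := ⟨MonoidHom.id M, fun _ _ => le_rfl⟩
  comp f g := ⟨g.toHom.comp f.toHom,
    fun _ _ => (g.nonexpanding _ _).trans (f.nonexpanding _ _)⟩

instance : MetricEnriched MonMet.{u} where
  homMetric X Y := supMetric (fun (f : Hom X Y) x => f.toHom x) fun _ _ h => Hom.ext_fun h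
  edist_comp_le f f' g g' := iSup_le fun x =>
    (edist_triangle _ (g.toHom (f'.toHom x)) _).trans <| add_le_add
      ((g.nonexpanding _ _).trans
        (le_iSup (fun x => edist (f.toHom x) (f'.toHom x)) x))
      (le_iSup (fun y => edist (g.toHom y) (g'.toHom y)) (f'.toHom x))

/-- The discrete monoid of words over the alphabet `A`. -/
def words (A : Type u) : MonMet.{u} where
  carrier := FreeMonoid A
  metric := discreteMetric _
  edist_mul_le x x' y y' := by
    by_cases hx : x = x'
    · by_cases hy : y = y'
      · subst hx hy; simp
      · simp [hy, edist]
    · simp [hx, edist]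

end MonMet

end

end QuantAlg


/-!
In `P ⊗ P` with the addition metric, the products `x · y` of elements of the two copies of `P`
double distances: if `f` and `g` are at distance `d` on each copy, then they are at distance `2 d`
on the products. So the points at which two homomorphisms are `ε`-close need not form a submonoid.
Concretely, `MonMet` lacks weak `ε`-equalizers of parallel pairs, which exist in varieties of
quantitative algebras and are inherited along enriched reflections; and the copowers of `G` are not
enriched copowers, so that `homFunctor G` has no enriched left adjoint unless `G` is trivial.

The discrete monoid on a monoid `N`, modulo relations `x =_ε y`, is a subregular quotient if for
every `ε` the relations form a submonoid of `N × N`. This holds for relations between the elements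
`s g` of a left zero band, `s g · s h = s g`. Let `N` consist of the endomorphisms of the space of
streams in `G`, and let `s g` replace the head of a stream by `g`. Multiplication of the head by `g`
is the composite of prepending `1`, of `s g`, and of multiplying the first two terms. Hence `G`
embeds in the quotient of the discrete monoid `N` by `s g =_ε s h` for `d(g, h) ≤ ε`. If `G` is
projective, then this embedding lifts to the discrete monoid, so `G` is discrete. It is then a
retract of a free monoid, and Levi's characterization of free monoids applies to it.
-/

namespace QuantAlg

noncomputable section

/-! ## Metric-enriched categories -/

section Enriched

variable {C : Type*} [Category* C] [MetricEnriched C] {D : Type*} [Category* D] [MetricEnriched D]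

theorem edist_comp_right_le {X Y Z : C} (f f' : X ⟶ Y) (g : Y ⟶ Z) :
    edist (f ≫ g) (f' ≫ g) ≤ edist f f' :=
  (MetricEnriched.edist_comp_le f f' g g).trans_eq (by rw [edist_self, add_zero])

theorem IsQuotient.epi {X Y : C} {p : X ⟶ Y} (hp : IsQuotient p) : Epi p where
  left_cancellation u₁ u₂ h := by rw [← edist_eq_zero, hp, h, edist_self]

theorem IsEnrichedFunctor.edist_homEquiv_symm_le {L : C ⥤ D} {R : D ⥤ C}
    (hL : IsEnrichedFunctor L) (adj : L ⊣ R) {X : C} {Y : D} (f g : X ⟶ R.obj Y) :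
    edist ((adj.homEquiv X Y).symm f) ((adj.homEquiv X Y).symm g) ≤ edist f g := by
  rw [adj.homEquiv_counit, adj.homEquiv_counit]
  exact (edist_comp_right_le _ _ _).trans (hL f g)

/-- A weak `ε`-equalizer of `f` and `g`: a weakly universal morphism `m` with
`d(f · m, g · m) ≤ ε`. Factorizations through `m` need not be unique. -/
structure IsWeakApproxEqualizer {B X Y : C} (m : B ⟶ X) (f g : X ⟶ Y) (ε : ℝ≥0∞) : Prop where
  edist_le : edist (m ≫ f) (m ≫ g) ≤ ε
  factors : ∀ ⦃K : C⦄ (h : K ⟶ X), edist (h ≫ f) (h ≫ g) ≤ ε → ∃ k : K ⟶ B, k ≫ m = h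

variable (C) in
/-- All parallel pairs have weak `ε`-equalizers for all `ε`. -/
def HasWeakApproxEqualizers : Prop :=
  ∀ ⦃X Y : C⦄ (f g : X ⟶ Y) (ε : ℝ≥0∞), ∃ (B : C) (m : B ⟶ X), IsWeakApproxEqualizer m f g ε

theorem IsWeakApproxEqualizer.homEquiv_symm {F : C ⥤ D} [F.Full] [F.Faithful] {L : D ⥤ C}
    (hF : IsEnrichedFunctor F) (hL : IsEnrichedFunctor L) (adj : L ⊣ F) {B : D} {X Y : C}
    {m : B ⟶ F.obj X} {f g : X ⟶ Y} {ε : ℝ≥0∞}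
    (hm : IsWeakApproxEqualizer m (F.map f) (F.map g) ε) :
    IsWeakApproxEqualizer ((adj.homEquiv B X).symm m) f g ε where
  edist_le := by
    rw [← adj.homEquiv_naturality_right_symm, ← adj.homEquiv_naturality_right_symm]
    exact (hL.edist_homEquiv_symm_le adj _ _).trans hm.edist_le
  factors K h hh := by
    obtain ⟨k, hk⟩ := hm.factors (F.map h) <| by
      rw [← F.map_comp, ← F.map_comp]
      exact (hF _ _).trans hh
    refine ⟨inv (adj.counit.app K) ≫ L.map k, ?_⟩
    rw [Category.assoc, ← adj.homEquiv_naturality_left_symm, hk, IsIso.inv_comp_eq,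
      adj.homEquiv_counit, adj.counit_naturality]

theorem HasWeakApproxEqualizers.of_reflective {F : C ⥤ D} [F.Full] [F.Faithful] {L : D ⥤ C}
    (hF : IsEnrichedFunctor F) (hL : IsEnrichedFunctor L) (adj : L ⊣ F)
    (hD : HasWeakApproxEqualizers D) : HasWeakApproxEqualizers C := fun _ _ f g ε =>
  let ⟨_, _, hm⟩ := hD (F.map f) (F.map g) ε
  ⟨_, _, hm.homEquiv_symm hF hL adj⟩

end Enriched

theorem edist_le_edist_discreteMetric {X Y : Type*} [EMetricSpace Y] (f : X → Y) (x x' : X) :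
    edist (f x) (f x') ≤ (discreteMetric X).edist x x' := by
  by_cases h : x = x'
  · rw [h, edist_self]
    exact zero_le
  · have h_top : (discreteMetric X).edist x x' = ⊤ := iSup_pos h
    exact le_top.trans_eq h_top.symm

/-- A set as a discrete metric space. -/
def Met.discrete (I : Type u) : Met.{u} :=
  @Met.mk I (discreteMetric I)

/-- A map out of a discrete metric space; it is automatically nonexpanding. -/
def Met.ofDiscrete {I : Type u} {X : Met.{u}} (f : I → X) : Met.discrete I ⟶ X :=
  Met.Hom.mk f (edist_le_edist_discreteMetric f)

section Tensors

variable {C : Type w} [Category.{v} C] [MetricEnriched C] {K : C}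

theorem IsSubregularGenerator.isSeparator (hK : IsSubregularGenerator K) : IsSeparator K := by
  obtain ⟨L, adj, -, hepi⟩ := hK
  have (X : C) : Epi (adj.counit.app X) :=
    let ⟨_, hD⟩ := hepi X
    hD.quotient.epi
  have := adj.faithful_R_of_epi_counit_app
  exact (isSeparator_def K).2 fun _ _ f g h =>
    (homFunctor K).map_injective (Met.Hom.ext (funext h))

/-- The copower is the tensor of `K` with the discrete space `I`. -/
theorem IsEnrichedFunctor.exists_copower {L : Met.{v} ⥤ C} (hL : IsEnrichedFunctor L)
    (adj : L ⊣ homFunctor K) (I : Type v) :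
    ∃ (B : C) (ι : I → (K ⟶ B)), ∀ X : C, ∃ desc : (I → (K ⟶ X)) → (B ⟶ X),
      (∀ f i, ι i ≫ desc f = f i) ∧
      ∀ f g, edist (desc f) (desc g) ≤ ⨆ i, edist (f i) (g i) := by
  let e (X : C) := adj.homEquiv (Met.discrete I) X
  let family {X : C} (f : I → (K ⟶ X)) : Met.discrete I ⟶ (homFunctor K).obj X := Met.ofDiscrete f
  refine ⟨L.obj (Met.discrete I), (adj.unit.app (Met.discrete I)).toFun, fun X =>
    ⟨fun f => (e X).symm (family f), fun f i => ?_,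
      fun f g => hL.edist_homEquiv_symm_le adj (family f) (family g)⟩⟩
  have h := (e X).apply_symm_apply (family f)
  rw [adj.homEquiv_unit] at h
  exact congrArg (fun k : Met.discrete I ⟶ (homFunctor K).obj X => k.toFun i) h

end Tensors

/-! ## Varieties of quantitative algebras -/

section Algebra

variable {S : Signature.{u}} {A B : Algebra.{u} S}

theorem Term.eval_hom {X : Type*} (h : A ⟶ B) (f : X → A) (t : Term S X) :
    h.toFun (t.eval A f) = t.eval B fun x => h.toFun (f x) := by
  induction t with
  | var x => rfl
  | app σ t ih => exact (h.map_op σ _).trans (congrArg (B.op σ) (funext ih))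

theorem Algebra.Satisfies.of_isometry {e : QuantEquation S} (hB : B.Satisfies e) (m : A ⟶ B)
    (hm : Isometry m.toFun) : A.Satisfies e := fun v => by
  rw [← hm.edist_eq, Term.eval_hom, Term.eval_hom]
  exact hB _

/-- The subalgebra of the points at which two homomorphisms have distance at most `ε`. -/
def Algebra.approxEqualizer (f g : A ⟶ B) (ε : ℝ≥0∞) : Algebra.{u} S where
  carrier := {x : A // edist (f.toFun x) (g.toFun x) ≤ ε}
  op σ x := ⟨A.op σ fun i => (x i).1, by
    rw [f.map_op, g.map_op]
    exact (B.op_nonexpanding _ _ _).trans (edist_pi_le_iff.mpr fun i => (x i).2)⟩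
  op_nonexpanding σ x y := A.op_nonexpanding σ (fun i => (x i).1) fun i => (y i).1

/-- The inclusion of `Algebra.approxEqualizer`. -/
def Algebra.approxEqualizerι (f g : A ⟶ B) (ε : ℝ≥0∞) : Algebra.approxEqualizer f g ε ⟶ A :=
  Algebra.Hom.mk Subtype.val (fun _ _ => rfl) fun _ _ => le_rfl

theorem Algebra.isWeakApproxEqualizer_approxEqualizerι (f g : A ⟶ B) (ε : ℝ≥0∞) :
    IsWeakApproxEqualizer (Algebra.approxEqualizerι f g ε) f g ε where
  edist_le := iSup_le Subtype.property
  factors _ h hh :=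
    ⟨Algebra.Hom.mk (fun x => ⟨h.toFun x, iSup_le_iff.mp hh x⟩)
      (fun σ x => Subtype.ext (h.map_op σ x)) h.nonexpanding, rfl⟩

theorem Variety.hasWeakApproxEqualizers (E : Set (QuantEquation S)) :
    HasWeakApproxEqualizers (Variety S E) := fun X Y f g ε => by
  have hm := Algebra.isWeakApproxEqualizer_approxEqualizerι f.hom g.hom ε
  let B : Variety S E := ⟨Algebra.approxEqualizer f.hom g.hom ε, fun e he =>
    (X.property e he).of_isometry (Algebra.approxEqualizerι f.hom g.hom ε) fun _ _ => rfl⟩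
  refine ⟨B, ObjectProperty.homMk (Algebra.approxEqualizerι f.hom g.hom ε), hm.edist_le,
    fun K h hh => ?_⟩
  obtain ⟨k, hk⟩ := hm.factors h.hom hh
  exact ⟨ObjectProperty.homMk k, ObjectProperty.hom_ext _ hk⟩

end Algebra

/-! ## Free monoids and their retracts -/

section Levi

variable {M N : Type*} [Monoid M] [Monoid N]

variable (M) in
/-- Levi's property of a monoid: any two factorizations of an element into two factors have a
common refinement. -/
def IsEquidivisible : Prop :=
  ∀ ⦃a b c d : M⦄, a * b = c * d → ∃ v, (c = a * v ∧ b = v * d) ∨ (a = c * v ∧ d = v * b)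

/-- An additive length on a monoid for which only the unit has length `0`. -/
structure IsLength (len : M → ℕ) : Prop where
  len_mul : ∀ x y, len (x * y) = len x + len y
  eq_one : ∀ ⦃x⦄, len x = 0 → x = 1

theorem isEquidivisible_freeMonoid (α : Type*) : IsEquidivisible (FreeMonoid α) :=
  fun _ _ _ _ h => (List.append_eq_append_iff.mp h).elim
    (fun ⟨v, hv⟩ => ⟨v, .inl hv⟩) fun ⟨v, hv⟩ => ⟨v, .inr hv⟩

theorem isLength_freeMonoid (α : Type*) : IsLength (FreeMonoid.length (α := α)) where
  len_mul := FreeMonoid.length_mul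
  eq_one _ := FreeMonoid.length_eq_zero.mp

theorem IsEquidivisible.of_leftInverse (hN : IsEquidivisible N) (i : M →* N) (r : N →* M)
    (hr : Function.LeftInverse r i) : IsEquidivisible M := fun a b c d h => by
  have retract {x y : M} {z : N} (hz : i x = z) (hy : r z = y) : x = y := by rw [← hy, ← hz, hr]
  obtain ⟨v, ⟨hc, hb⟩ | ⟨ha, hd⟩⟩ := hN (a := i a) (b := i b) (c := i c) (d := i d) <| by
    rw [← map_mul, ← map_mul, h]
  · exact ⟨r v, .inl ⟨retract hc (by rw [map_mul, hr]), retract hb (by rw [map_mul, hr])⟩⟩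
  · exact ⟨r v, .inr ⟨retract ha (by rw [map_mul, hr]), retract hd (by rw [map_mul, hr])⟩⟩

namespace IsLength

variable {len : M → ℕ}

theorem comp_injective {len : N → ℕ} (h : IsLength len) {i : M →* N}
    (hi : Function.Injective i) : IsLength fun x => len (i x) where
  len_mul x y := by rw [i.map_mul, h.len_mul]
  eq_one x hx := hi ((h.eq_one hx).trans i.map_one.symm)

theorem isUnit_iff (h : IsLength len) {x : M} : IsUnit x ↔ x = 1 := by
  refine ⟨fun hx => h.eq_one ?_, fun hx => hx ▸ isUnit_one⟩
  obtain ⟨y, hxy⟩ := hx.exists_right_inv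
  have h_one := h.len_mul 1 1
  have h_mul := h.len_mul x y
  rw [mul_one] at h_one
  rw [hxy] at h_mul
  omega

theorem lift_irreducible_surjective (h : IsLength len) :
    Function.Surjective (FreeMonoid.lift (Subtype.val : {x : M // Irreducible x} → M)) := by
  suffices ∀ (n : ℕ) (x : M), len x = n →
      x ∈ MonoidHom.mrange (FreeMonoid.lift (Subtype.val : {x : M // Irreducible x} → M)) from
    fun x => this _ x rfl
  intro n
  induction n using Nat.strong_induction_on with
  | _ n ih =>
    rintro x rfl
    by_cases hx : x = 1
    · exact hx ▸ one_mem _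
    by_cases hirr : Irreducible x
    · exact ⟨FreeMonoid.of ⟨x, hirr⟩, FreeMonoid.lift_eval_of _ _⟩
    obtain ⟨y, z, rfl, hy, hz⟩ : ∃ y z, x = y * z ∧ y ≠ 1 ∧ z ≠ 1 := by
      by_contra! hcon
      refine hirr ⟨h.isUnit_iff.not.mpr hx, fun y z hyz => ?_⟩
      rw [h.isUnit_iff, h.isUnit_iff, or_iff_not_imp_left]
      exact hcon y z hyz
    have hy_pos := Nat.pos_of_ne_zero (hy ∘ @h.eq_one y)
    have hz_pos := Nat.pos_of_ne_zero (hz ∘ @h.eq_one z)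
    have hlen := h.len_mul y z
    exact mul_mem (ih _ (by omega) y rfl) (ih _ (by omega) z rfl)

theorem irreducible_mul_ne_one (h : IsLength len) {a : M} (ha : Irreducible a) (x : M) :
    a * x ≠ 1 := fun hax => by
  have h_one := h.len_mul 1 1
  have h_mul := h.len_mul a x
  rw [mul_one] at h_one
  rw [hax] at h_mul
  exact ha.not_isUnit (h.isUnit_iff.mpr (h.eq_one (by omega)))

theorem eq_and_eq_of_irreducible_mul_eq (h : IsLength len) (hM : IsEquidivisible M) {a b x y : M}
    (ha : Irreducible a) (hb : Irreducible b) (hxy : a * x = b * y) : a = b ∧ x = y := by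
  obtain ⟨v, ⟨rfl, rfl⟩ | ⟨rfl, rfl⟩⟩ := hM hxy
  · obtain rfl := h.isUnit_iff.mp ((hb.isUnit_or_isUnit rfl).resolve_left ha.not_isUnit)
    exact ⟨(mul_one a).symm, one_mul y⟩
  · obtain rfl := h.isUnit_iff.mp ((ha.isUnit_or_isUnit rfl).resolve_left hb.not_isUnit)
    exact ⟨mul_one b, (one_mul x).symm⟩

theorem lift_irreducible_injective (h : IsLength len) (hM : IsEquidivisible M) :
    Function.Injective (FreeMonoid.lift (Subtype.val : {x : M // Irreducible x} → M)) := by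
  intro w
  induction w using FreeMonoid.inductionOn' with
  | one =>
    intro w' hw
    cases w' using FreeMonoid.casesOn with
    | one => rfl
    | of_mul b w' =>
      rw [map_one, map_mul, FreeMonoid.lift_eval_of] at hw
      exact absurd hw.symm (h.irreducible_mul_ne_one b.2 _)
  | of_mul a w ih =>
    intro w' hw
    cases w' using FreeMonoid.casesOn with
    | one =>
      rw [map_one, map_mul, FreeMonoid.lift_eval_of] at hw
      exact absurd hw (h.irreducible_mul_ne_one a.2 _)
    | of_mul b w' =>
      rw [map_mul, map_mul, FreeMonoid.lift_eval_of, FreeMonoid.lift_eval_of] at hw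
      obtain ⟨hab, hww'⟩ := h.eq_and_eq_of_irreducible_mul_eq hM a.2 b.2 hw
      rw [Subtype.ext hab, ih hww']

/-- Levi's theorem: an equidivisible monoid with a length is free on its irreducible elements. -/
def freeMonoidEquiv (h : IsLength len) (hM : IsEquidivisible M) :
    FreeMonoid {x : M // Irreducible x} ≃* M :=
  MulEquiv.ofBijective _ ⟨h.lift_irreducible_injective hM, h.lift_irreducible_surjective⟩

end IsLength

end Levi

namespace MonMet

/-! ## Doubled distances in products with the addition metric -/

section Basic

variable {M N P : MonMet.{u}}

theorem edist_hom_le_iff {f g : M ⟶ N} {r : ℝ≥0∞} :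
    edist f g ≤ r ↔ ∀ x, edist (f.toHom x) (g.toHom x) ≤ r :=
  iSup_le_iff

theorem edist_apply_le (f g : M ⟶ N) (x : M) : edist (f.toHom x) (g.toHom x) ≤ edist f g :=
  edist_hom_le_iff.mp le_rfl x

theorem hom_congr {f g : M ⟶ N} (h : f = g) (x : M) : f.toHom x = g.toHom x := by rw [h]

variable (M N) in
/-- The constant homomorphism with value `1`. -/
def trivialHom : M ⟶ N :=
  Hom.mk 1 fun _ _ => (edist_self (1 : N)).trans_le zero_le

theorem trivialHom_comp (f : N ⟶ P) : trivialHom M N ≫ f = trivialHom M P :=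
  Hom.ext_fun (funext fun _ => map_one f.toHom)

theorem comp_trivialHom (f : M ⟶ N) : f ≫ trivialHom N P = trivialHom M P :=
  rfl

theorem nontrivial_of_isSeparator (hM : IsSeparator M) : Nontrivial M := by
  by_contra h
  rw [not_nontrivial_iff_subsingleton] at h
  obtain ⟨x, hx⟩ := exists_ne (1 : FreeMonoid PUnit.{u + 1})
  refine hx (hom_congr (M := words PUnit.{u + 1})
    ((isSeparator_def M).1 hM (𝟙 _) (trivialHom _ _) fun f => ?_) x)
  refine Hom.ext_fun (funext fun y => ?_)
  rw [Subsingleton.elim y 1, map_one, map_one]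

end Basic

section Truncate

variable (M : MonMet.{u})

/-- The monoid `M` with its metric truncated at `1`. -/
def truncate : MonMet.{u} where
  carrier := M
  metric :=
    { edist x y := min 1 (edist x y)
      edist_self x := by rw [edist_self, min_zero]
      edist_comm x y := by rw [edist_comm]
      edist_triangle x y z := (min_le_min_left 1 (edist_triangle x y z)).trans
        ((min_add_distrib 1 _ _).trans_le (min_le_right _ _))
      eq_of_edist_eq_zero h := eq_of_edist_eq_zero
        ((min_eq_iff.mp h).resolve_left fun h => one_ne_zero h.1).1 }
  monoid := M.monoid
  edist_mul_le x x' y y' := (min_le_min_left 1 (M.edist_mul_le x x' y y')).trans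
    ((min_add_distrib 1 _ _).trans_le (min_le_right _ _))

/-- The identity map to the truncation. -/
def toTruncate : M ⟶ truncate M :=
  Hom.mk (MonoidHom.id M) fun _ _ => min_le_right _ _

variable {M} in
theorem edist_truncate_ne_top {K : MonMet.{u}} (f g : K ⟶ truncate M) : edist f g ≠ ⊤ :=
  ne_top_of_le_ne_top ENNReal.one_ne_top (edist_hom_le_iff.mpr fun _ => min_le_left _ _)

theorem edist_toTruncate_trivialHom_ne_zero [Nontrivial M] :
    edist (toTruncate M) (trivialHom M (truncate M)) ≠ 0 := fun h => by
  obtain ⟨x, hx⟩ := exists_ne (1 : M)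
  exact hx (hom_congr (eq_of_edist_eq_zero h) x)

end Truncate

section AddProd

/-- The addition metric on a cartesian product. -/
abbrev additionMetric (X Y : Type*) [EMetricSpace X] [EMetricSpace Y] : EMetricSpace (X × Y) :=
  EMetricSpace.induced (WithLp.toLp 1) (WithLp.toLp_injective 1) inferInstance

theorem edist_additionMetric {X Y : Type*} [EMetricSpace X] [EMetricSpace Y] (p q : X × Y) :
    (additionMetric X Y).edist p q = edist p.1 q.1 + edist p.2 q.2 := by
  refine (WithLp.prod_edist_eq_add (p := 1) (by norm_num) _ _).trans ?_
  simp

/-- The product of two metric monoids with the addition metric. -/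
def addProd (M N : MonMet.{u}) : MonMet.{u} where
  carrier := M × N
  metric := additionMetric M N
  monoid := inferInstanceAs (Monoid (M × N))
  edist_mul_le x x' y y' := by
    simp only [edist_additionMetric]
    exact (add_le_add (M.edist_mul_le x.1 x'.1 y.1 y'.1)
      (N.edist_mul_le x.2 x'.2 y.2 y'.2)).trans_eq (add_add_add_comm _ _ _ _)

variable {M N K₁ K₂ B : MonMet.{u}}

theorem edist_addProd (x y : addProd M N) : edist x y = edist x.1 y.1 + edist x.2 y.2 :=
  edist_additionMetric x y

variable (M N) in
/-- The first embedding in a product with the addition metric. -/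
def inl : M ⟶ addProd M N :=
  Hom.mk (MonoidHom.inl M N) fun x x' =>
    (edist_addProd (M := M) (N := N) (x, 1) (x', 1)).trans_le (by rw [edist_self, add_zero])

variable (M N) in
/-- The second embedding in a product with the addition metric. -/
def inr : N ⟶ addProd M N :=
  Hom.mk (MonoidHom.inr M N) fun x x' =>
    (edist_addProd (M := M) (N := N) (1, x) (1, x')).trans_le (by rw [edist_self, zero_add])

theorem edist_inl_mul_inr (x x' : M) (y y' : N) :
    edist ((inl M N).toHom x * (inr M N).toHom y) ((inl M N).toHom x' * (inr M N).toHom y') =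
      edist x x' + edist y y' := by
  have h_fst (x : M) (y : N) : ((inl M N).toHom x * (inr M N).toHom y).1 = x := mul_one x
  have h_snd (x : M) (y : N) : ((inl M N).toHom x * (inr M N).toHom y).2 = y := one_mul y
  rw [edist_addProd, h_fst, h_fst, h_snd, h_snd]

/-- Distances add up on the products `k₁ x * k₂ y`: no metric monoid `B` can contain both factors
and keep `f` and `g` as close as they are on each of them. -/
theorem edist_add_edist_le (k₁ : K₁ ⟶ B) (k₂ : K₂ ⟶ B) {f g : B ⟶ addProd M N}
    {φ₁ ψ₁ : K₁ ⟶ M} {φ₂ ψ₂ : K₂ ⟶ N} (hf₁ : k₁ ≫ f = φ₁ ≫ inl M N) (hg₁ : k₁ ≫ g = ψ₁ ≫ inl M N)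
    (hf₂ : k₂ ≫ f = φ₂ ≫ inr M N) (hg₂ : k₂ ≫ g = ψ₂ ≫ inr M N) :
    edist φ₁ ψ₁ + edist φ₂ ψ₂ ≤ edist f g := by
  refine ENNReal.iSup_add_iSup_le fun x y => ?_
  have hf : f.toHom (k₁.toHom x * k₂.toHom y) =
      (inl M N).toHom (φ₁.toHom x) * (inr M N).toHom (φ₂.toHom y) := by
    rw [map_mul]
    exact congrArg₂ _ (hom_congr hf₁ x) (hom_congr hf₂ y)
  have hg : g.toHom (k₁.toHom x * k₂.toHom y) =
      (inl M N).toHom (ψ₁.toHom x) * (inr M N).toHom (ψ₂.toHom y) := by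
    rw [map_mul]
    exact congrArg₂ _ (hom_congr hg₁ x) (hom_congr hg₂ y)
  have h := edist_apply_le f g (k₁.toHom x * k₂.toHom y)
  rwa [hf, hg, edist_inl_mul_inr] at h

end AddProd

theorem not_edist_add_self_le (G : MonMet.{u}) [Nontrivial G] :
    ¬ edist (toTruncate G) (trivialHom G _) + edist (toTruncate G) (trivialHom G _) ≤
      edist (toTruncate G) (trivialHom G _) :=
  not_le.mpr (ENNReal.lt_add_right (edist_truncate_ne_top _ _)
    (edist_toTruncate_trivialHom_ne_zero G))

theorem not_hasWeakApproxEqualizers : ¬ HasWeakApproxEqualizers MonMet.{u} := fun h => by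
  let G : MonMet.{u} := words PUnit
  have : Nontrivial G := inferInstanceAs (Nontrivial (FreeMonoid PUnit))
  let P := truncate G
  let φ := toTruncate G
  let ψ := trivialHom G P
  obtain ⟨B, m, hm⟩ := h (𝟙 (addProd P P)) (trivialHom _ _) (edist φ ψ)
  obtain ⟨k₁, hk₁⟩ := hm.factors (φ ≫ inl P P)
    (by
      rw [Category.comp_id, comp_trivialHom, ← trivialHom_comp (inl P P)]
      exact edist_comp_right_le φ ψ _)
  obtain ⟨k₂, hk₂⟩ := hm.factors (φ ≫ inr P P)
    (by
      rw [Category.comp_id, comp_trivialHom, ← trivialHom_comp (inr P P)]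
      exact edist_comp_right_le φ ψ _)
  have h_trivial {K : MonMet.{u}} (k : K ⟶ B) (i : P ⟶ addProd P P) :
      k ≫ m ≫ trivialHom _ _ = trivialHom K P ≫ i := (trivialHom_comp i).symm
  refine not_edist_add_self_le G ((edist_add_edist_le k₁ k₂ ?_ (h_trivial k₁ _) ?_
    (h_trivial k₂ _)).trans hm.edist_le)
  · rwa [Category.comp_id]
  · rwa [Category.comp_id]

theorem not_isEnrichedFunctor_of_nontrivial {G : MonMet.{u}} [Nontrivial G]
    {L : Met.{u} ⥤ MonMet.{u}} (adj : L ⊣ homFunctor G) : ¬ IsEnrichedFunctor L := fun hL => by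
  let P := truncate G
  let φ := toTruncate G
  let ψ := trivialHom G P
  obtain ⟨B, ι, h⟩ := hL.exists_copower adj (ULift Bool)
  obtain ⟨desc, h_desc, h_edist⟩ := h (addProd P P)
  let embed (i : ULift.{u} Bool) : P ⟶ addProd P P := bif i.down then inr P P else inl P P
  have h_le : edist (desc fun i => φ ≫ embed i) (desc fun i => ψ ≫ embed i) ≤ edist φ ψ :=
    (h_edist _ _).trans (iSup_le fun i => edist_comp_right_le φ ψ (embed i))
  exact not_edist_add_self_le G ((edist_add_edist_le (ι ⟨false⟩) (ι ⟨true⟩) (h_desc _ _)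
    (h_desc _ _) (h_desc _ _) (h_desc _ _)).trans h_le)

theorem not_isSubregularGenerator (G : MonMet.{u}) : ¬ IsSubregularGenerator G := fun hG => by
  have := nontrivial_of_isSeparator hG.isSeparator
  obtain ⟨L, adj, hL, -⟩ := hG
  exact not_isEnrichedFunctor_of_nontrivial adj hL

/-! ## Discrete and presented metric monoids -/

section Discrete

variable {M N : MonMet.{u}}

/-- Distinct elements of `M` have distance `∞`. -/
def IsDiscrete (M : MonMet.{u}) : Prop :=
  ∀ ⦃x y : M⦄, x ≠ y → edist x y = ⊤

/-- A homomorphism out of a discrete metric monoid; it is automatically nonexpanding. -/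
def IsDiscrete.hom (hM : IsDiscrete M) (f : M →* N) : M ⟶ N :=
  Hom.mk f fun x y => by
    by_cases h : x = y
    · rw [h, edist_self, edist_self]
    · exact le_top.trans_eq (hM h).symm

/-- A discrete metric monoid carries no more structure than its underlying monoid. -/
def IsDiscrete.isoOfMulEquiv (hM : IsDiscrete M) (hN : IsDiscrete N) (e : M ≃* N) : M ≅ N where
  hom := hM.hom e.toMonoidHom
  inv := hN.hom e.symm.toMonoidHom
  hom_inv_id := Hom.ext_fun (funext e.symm_apply_apply)
  inv_hom_id := Hom.ext_fun (funext e.apply_symm_apply)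

/-- A monoid with the discrete metric. -/
def discrete (F : Type u) [Monoid F] : MonMet.{u} where
  carrier := F
  metric := discreteMetric F
  edist_mul_le x x' y y' := by
    let := discreteMetric F
    exact (edist_triangle _ (x' * y) _).trans (add_le_add
      (edist_le_edist_discreteMetric (· * y) x x') (edist_le_edist_discreteMetric (x' * ·) y y'))

theorem isDiscrete_discrete (F : Type u) [Monoid F] : IsDiscrete (discrete F) :=
  fun _ _ h => iSup_pos h

theorem isDiscrete_words (A : Type u) : IsDiscrete (words A) :=
  isDiscrete_discrete (FreeMonoid A)

end Discrete

section Descent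

variable {F : Type*} [Monoid F] {M N : MonMet.{u}}

theorem eq_of_edist_le {f : F →* M} {g : F →* N} {x y : F}
    (h : edist (g x) (g y) ≤ edist (f x) (f y)) (hf : f x = f y) : g x = g y :=
  edist_le_zero.mp (h.trans_eq (edist_eq_zero.mpr hf))

/-- The factorization of `g` through a surjective homomorphism `p`, if `g` is nonexpanding with
respect to the distances after `p`. -/
def descOfSurjective (p : F →* M) (hp : Function.Surjective p) (g : F →* N)
    (h : ∀ x y, edist (g x) (g y) ≤ edist (p x) (p y)) : M ⟶ N :=
  Hom.mk
    { toFun y := g (Function.surjInv hp y)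
      map_one' := (eq_of_edist_le (h _ 1) (by rw [Function.surjInv_eq hp, map_one])).trans
        (map_one g)
      map_mul' x y := (eq_of_edist_le (h _ (Function.surjInv hp x * Function.surjInv hp y))
        (by simp only [map_mul, Function.surjInv_eq hp])).trans (map_mul g _ _) }
    fun x y => (h _ _).trans_eq (by rw [Function.surjInv_eq hp, Function.surjInv_eq hp])

theorem descOfSurjective_apply (p : F →* M) (hp : Function.Surjective p) (g : F →* N)
    (h : ∀ x y, edist (g x) (g y) ≤ edist (p x) (p y)) (x : F) :
    (descOfSurjective p hp g h).toHom (p x) = g x :=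
  eq_of_edist_le (h _ _) (Function.surjInv_eq hp _)

end Descent

section Presented

variable {F : Type u} [Monoid F]

/-- A homomorphism respects the relations `R` if it maps all pairs in `R ε` to elements of distance
at most `ε`. -/
def Respects (R : ℝ≥0 → Set (F × F)) {N : MonMet.{u}} (f : F →* N) : Prop :=
  ∀ ε, ∀ p ∈ R ε, edist (f p.1) (f p.2) ≤ (ε : ℝ≥0∞)

/-- The monoid `F` with the largest pseudometric making multiplication nonexpanding and all pairs
in `R ε` at most `ε` apart, encoded as the supremum of the pseudometrics induced by the
homomorphisms that respect `R`. -/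
def PrePresented (_ : ℝ≥0 → Set (F × F)) : Type u :=
  F

namespace PrePresented

variable (R : ℝ≥0 → Set (F × F))

instance : Monoid (PrePresented R) :=
  inferInstanceAs (Monoid F)

instance : PseudoEMetricSpace (PrePresented R) where
  edist x y := ⨆ f : Σ N : MonMet.{u}, {f : F →* N // Respects R f}, edist (f.2.1 x) (f.2.1 y)
  edist_self x := le_antisymm (iSup_le fun f => (edist_self (f.2.1 x)).le) zero_le
  edist_comm x y := by simp only [edist_comm]
  edist_triangle x y z := iSup_le fun f => (edist_triangle _ (f.2.1 y) _).trans (add_le_add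
    (le_iSup (fun f : Σ N : MonMet.{u}, {f : F →* N // Respects R f} =>
      edist (f.2.1 x) (f.2.1 y)) f)
    (le_iSup (fun f : Σ N : MonMet.{u}, {f : F →* N // Respects R f} =>
      edist (f.2.1 y) (f.2.1 z)) f))

variable {R}

theorem edist_le_iff {x y : PrePresented R} {r : ℝ≥0∞} : edist x y ≤ r ↔
    ∀ (N : MonMet.{u}) (f : F →* N), Respects R f → edist (f x) (f y) ≤ r :=
  iSup_le_iff.trans ⟨fun h N f hf => h ⟨N, f, hf⟩, fun h f => h f.1 f.2.1 f.2.2⟩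

theorem edist_mul_le (x x' y y' : PrePresented R) :
    edist (x * y) (x' * y') ≤ edist x x' + edist y y' :=
  edist_le_iff.mpr fun N f hf =>
    calc
      edist (f (x * y)) (f (x' * y')) = edist (f x * f y) (f x' * f y') :=
        congrArg₂ edist (map_mul f x y) (map_mul f x' y')
      _ ≤ edist (f x) (f x') + edist (f y) (f y') := N.edist_mul_le _ _ _ _
      _ ≤ edist x x' + edist y y' :=
        add_le_add (edist_le_iff.mp le_rfl N f hf) (edist_le_iff.mp le_rfl N f hf)

instance : ContinuousMul (PrePresented R) where
  continuous_mul := LipschitzWith.continuous (K := 2) fun p q => by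
    refine (edist_mul_le _ _ _ _).trans ?_
    rw [ENNReal.coe_ofNat, two_mul]
    exact add_le_add (le_max_left _ _) (le_max_right _ _)

end PrePresented

/-- The universal metric monoid with a homomorphism from `F` that respects the relations `R`. -/
def presented (R : ℝ≥0 → Set (F × F)) : MonMet.{u} where
  carrier := SeparationQuotient (PrePresented R)
  edist_mul_le x x' y y' := by
    obtain ⟨x, rfl⟩ := SeparationQuotient.surjective_mk x
    obtain ⟨x', rfl⟩ := SeparationQuotient.surjective_mk x'
    obtain ⟨y, rfl⟩ := SeparationQuotient.surjective_mk y
    obtain ⟨y', rfl⟩ := SeparationQuotient.surjective_mk y'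
    simp only [← SeparationQuotient.mk_mul, SeparationQuotient.edist_mk]
    exact PrePresented.edist_mul_le _ _ _ _

/-- The universal homomorphism to `presented R`. -/
def toPresented (R : ℝ≥0 → Set (F × F)) : F →* presented R :=
  SeparationQuotient.mkMonoidHom (M := PrePresented R)

variable {R : ℝ≥0 → Set (F × F)}

theorem toPresented_surjective : Function.Surjective (toPresented R) :=
  SeparationQuotient.surjective_mk (X := PrePresented R)

theorem edist_toPresented_le_iff {x y : F} {r : ℝ≥0∞} :
    edist (toPresented R x) (toPresented R y) ≤ r ↔
      ∀ (N : MonMet.{u}) (f : F →* N), Respects R f → edist (f x) (f y) ≤ r :=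
  Iff.trans (iff_of_eq (congrArg (· ≤ r) (SeparationQuotient.edist_mk (X := PrePresented R) x y)))
    PrePresented.edist_le_iff

theorem respects_toPresented (R : ℝ≥0 → Set (F × F)) : Respects R (toPresented R) :=
  fun _ _ hp => edist_toPresented_le_iff.mpr fun _ _ hf => hf _ _ hp

theorem edist_toPresented_le {x y : F} {r : ℝ≥0∞} (h : ∀ ε : ℝ≥0, r ≤ ε → (x, y) ∈ R ε) :
    edist (toPresented R x) (toPresented R y) ≤ r := by
  induction r with
  | top => exact le_top
  | coe ε => exact respects_toPresented R ε _ (h ε le_rfl)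

theorem Respects.edist_le {N : MonMet.{u}} {f : F →* N} (hf : Respects R f) (x y : F) :
    edist (f x) (f y) ≤ edist (toPresented R x) (toPresented R y) :=
  edist_toPresented_le_iff.mp le_rfl N f hf

theorem presented_hom_ext {N : MonMet.{u}} {f g : presented R ⟶ N}
    (h : ∀ x, f.toHom (toPresented R x) = g.toHom (toPresented R x)) : f = g :=
  Hom.ext_fun (funext (toPresented_surjective.forall.mpr h))

end Presented

/-! ## Left adjoints of hom-functors -/

section Tensor

variable (M : Met.{u}) (G : MonMet.{u})

/-- The free product of copies of the monoid `G` indexed by the points of `M`. -/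
abbrev Copies : Type u :=
  Monoid.CoprodI fun _ : M => (G : Type u)

variable {M G} {N : MonMet.{u}}

/-- The copy of `G` at a point of `M`. -/
def copy (m : M) : G →* Copies M G :=
  Monoid.CoprodI.of (M := fun _ : M => (G : Type u)) (i := m)

theorem copies_hom_ext {f g : Copies M G →* N} (h : ∀ m, f.comp (copy m) = g.comp (copy m)) :
    f = g :=
  Monoid.CoprodI.ext_hom f g h

/-- The homomorphism on the free product of copies of `G` given by a family of homomorphisms. -/
def copiesLift (g : M ⟶ (homFunctor G).obj N) : Copies M G →* N :=
  Monoid.CoprodI.lift (M := fun _ : M => (G : Type u)) fun m => Hom.toHom (g.toFun m)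

theorem copiesLift_copy (g : M ⟶ (homFunctor G).obj N) (m : M) (x : G) :
    copiesLift g (copy m x) = Hom.toHom (g.toFun m) x :=
  Monoid.CoprodI.lift_of (M := fun _ : M => (G : Type u)) _ x

variable (M G) in
/-- The relations of the tensor of `M` and `G`: they make the copies of `G` nonexpanding, jointly
with their index. -/
def tensorRel (ε : ℝ≥0) : Set (Copies M G × Copies M G) :=
  {p | ∃ (m m' : M) (x x' : G), edist m m' + edist x x' ≤ (ε : ℝ≥0∞) ∧
    p = (copy m x, copy m' x')}

variable (M G) in
/-- The tensor `M ⊗ G`. -/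
abbrev tensor : MonMet.{u} :=
  presented (tensorRel M G)

theorem edist_toPresented_copy_le (m m' : M) (x x' : G) :
    edist (toPresented (tensorRel M G) (copy m x)) (toPresented (tensorRel M G) (copy m' x')) ≤
      edist m m' + edist x x' :=
  edist_toPresented_le fun _ h => ⟨m, m', x, x', h, rfl⟩

/-- The copy of `G` in `M ⊗ G` at a point of `M`. -/
def tensorι (m : M) : G ⟶ tensor M G :=
  Hom.mk ((toPresented (tensorRel M G)).comp (copy m)) fun x x' =>
    (edist_toPresented_copy_le m m x x').trans_eq (by rw [edist_self, zero_add])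

theorem edist_tensorι_le (m m' : M) :
    edist (tensorι m : G ⟶ tensor M G) (tensorι m') ≤ edist m m' :=
  edist_hom_le_iff.mpr fun x =>
    (edist_toPresented_copy_le m m' x x).trans_eq (by rw [edist_self, add_zero])

theorem respects_copiesLift (g : M ⟶ (homFunctor G).obj N) :
    Respects (tensorRel M G) (copiesLift g) := by
  rintro ε _ ⟨m, m', x, x', h, rfl⟩
  simp only [copiesLift_copy]
  calc
    edist (Hom.toHom (g.toFun m) x) (Hom.toHom (g.toFun m') x')
      ≤ edist (Hom.toHom (g.toFun m) x) (Hom.toHom (g.toFun m') x) +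
          edist (Hom.toHom (g.toFun m') x) (Hom.toHom (g.toFun m') x') := edist_triangle _ _ _
    _ ≤ edist m m' + edist x x' := add_le_add
      ((edist_apply_le (g.toFun m) (g.toFun m') x).trans (g.nonexpanding m m'))
      (Hom.nonexpanding (g.toFun m') x x')
    _ ≤ ε := h

/-- The homomorphism on `M ⊗ G` given by a nonexpanding family of homomorphisms. -/
def tensorDesc (g : M ⟶ (homFunctor G).obj N) : tensor M G ⟶ N :=
  descOfSurjective _ toPresented_surjective _ (respects_copiesLift g).edist_le

theorem tensorDesc_toPresented (g : M ⟶ (homFunctor G).obj N) (x : Copies M G) :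
    (tensorDesc g).toHom (toPresented (tensorRel M G) x) = copiesLift g x :=
  descOfSurjective_apply _ _ _ _ x

/-- The nonexpanding family of the restrictions to the copies of `G` in `M ⊗ G`. -/
def tensorCurry (f : tensor M G ⟶ N) : M ⟶ (homFunctor G).obj N :=
  Met.Hom.mk (fun m => tensorι m ≫ f) fun m m' =>
    (edist_comp_right_le _ _ f).trans (edist_tensorι_le m m')

theorem copiesLift_tensorCurry (f : tensor M G ⟶ N) :
    copiesLift (tensorCurry f) = f.toHom.comp (toPresented (tensorRel M G)) :=
  copies_hom_ext fun m => MonoidHom.ext fun x => copiesLift_copy (tensorCurry f) m x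

/-- The universal property of the tensor. -/
def tensorHomEquiv (M : Met.{u}) (G N : MonMet.{u}) :
    (tensor M G ⟶ N) ≃ (M ⟶ (homFunctor G).obj N) where
  toFun := tensorCurry
  invFun := tensorDesc
  left_inv f := presented_hom_ext fun x => by
    rw [tensorDesc_toPresented, copiesLift_tensorCurry, MonoidHom.comp_apply]
  right_inv g := Met.Hom.ext <| funext fun m => Hom.ext_fun <| funext fun x =>
    (tensorDesc_toPresented g _).trans (copiesLift_copy g m x)

theorem isRightAdjoint_homFunctor (G : MonMet.{u}) : (homFunctor G).IsRightAdjoint :=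
  (Adjunction.adjunctionOfEquivLeft (fun M N => tensorHomEquiv M G N)
    fun _ _ _ _ _ => rfl).isRightAdjoint

end Tensor

/-! ## Subregular epimorphisms from discrete metric monoids -/

section SubregularEpi

variable {F : Type u} [Monoid F]

/-- The basic diagram of an increasing family of submonoids of `X × X`, with the two projections.
The submonoids carry the discrete metric, so that nothing but the compatibility condition restricts
the morphisms out of its colimit. -/
def basicDiagram (X : MonMet.{u}) {S : ℝ≥0 → Submonoid (X × X)} (hS : Monotone S) :
    BasicDiagram X where
  D :=
    { obj ε := discrete (S ε)
      map h := (isDiscrete_discrete _).hom (Submonoid.inclusion (hS h.le)) }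
  l := { app ε := (isDiscrete_discrete _).hom ((MonoidHom.fst X X).comp (S ε).subtype) }
  r := { app ε := (isDiscrete_discrete _).hom ((MonoidHom.snd X X).comp (S ε).subtype) }

theorem compatible_basicDiagram_iff {X Y : MonMet.{u}} {S : ℝ≥0 → Submonoid (X × X)}
    (hS : Monotone S) (f : X ⟶ Y) :
    (basicDiagram X hS).Compatible f ↔ Respects (fun ε => S ε) f.toHom :=
  forall_congr' fun _ => edist_hom_le_iff.trans Subtype.forall

theorem isSubregularEpi_of_surjective {X Y : MonMet.{u}} {f : X ⟶ Y}
    (hf : Function.Surjective f.toHom) {S : ℝ≥0 → Submonoid (X × X)} (hS : Monotone S)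
    (hfS : Respects (fun ε => S ε) f.toHom)
    (h : ∀ (Z : MonMet.{u}) (g : X →* Z), Respects (fun ε => S ε) g →
      ∀ x y, edist (g x) (g y) ≤ edist (f.toHom x) (f.toHom y)) :
    IsSubregularEpi f := by
  refine ⟨basicDiagram X hS, (compatible_basicDiagram_iff hS f).mpr hfS, fun U u₁ u₂ => ?_,
    fun Z g hg => ?_⟩
  · exact (hf.iSup_comp fun y => edist (u₁.toHom y) (u₂.toHom y)).symm
  · have hgf := h Z g.toHom ((compatible_basicDiagram_iff hS g).mp hg)
    exact ⟨descOfSurjective f.toHom hf g.toHom hgf,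
      Hom.ext_fun (funext (descOfSurjective_apply f.toHom hf g.toHom hgf))⟩

theorem isSubregularEpi_toPresented {S : ℝ≥0 → Submonoid (F × F)} (hS : Monotone S) :
    IsSubregularEpi ((isDiscrete_discrete F).hom (toPresented (F := F) fun ε => S ε)) :=
  isSubregularEpi_of_surjective (X := discrete F) (S := S) toPresented_surjective hS
    (respects_toPresented (F := F) _) fun _ _ hg => hg.edist_le

theorem IsDiscrete.isSubregularEpi_of_surjective {G : MonMet.{u}} (hG : IsDiscrete G)
    {p : F →* G} (hp : Function.Surjective p) :
    IsSubregularEpi ((isDiscrete_discrete F).hom p) := by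
  let S : Submonoid (F × F) :=
    (p.comp (MonoidHom.fst F F)).eqLocusM (p.comp (MonoidHom.snd F F))
  refine MonMet.isSubregularEpi_of_surjective (X := discrete F) hp (monotone_const (c := S))
    (fun _ _ hq => (edist_eq_zero.mpr hq).trans_le zero_le) fun _ g hg x y => ?_
  by_cases h : p x = p y
  · exact (hg 0 (x, y) h).trans zero_le
  · exact le_top.trans_eq (hG h).symm

end SubregularEpi

/-! ## Projectives are discrete -/

section Band

variable {G N : MonMet.{u}} {s : G → N}

/-- The pairs of values of `s` at points of distance at most `ε`, together with `(1, 1)`. -/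
def bandRel (hs : ∀ g h, s g * s h = s g) (ε : ℝ≥0) : Submonoid (N × N) where
  carrier := {p | p = 1 ∨ ∃ g h, edist g h ≤ (ε : ℝ≥0∞) ∧ p = (s g, s h)}
  one_mem' := .inl rfl
  mul_mem' := by
    rintro _ q (rfl | ⟨g, h, hgh, rfl⟩) (rfl | ⟨g', h', hgh', rfl⟩)
    · exact .inl (one_mul 1)
    · exact .inr ⟨g', h', hgh', one_mul _⟩
    · exact .inr ⟨g, h, hgh, mul_one _⟩
    · exact .inr ⟨g, h, hgh, Prod.ext (hs g g') (hs h h')⟩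

theorem monotone_bandRel (hs : ∀ g h, s g * s h = s g) : Monotone (bandRel hs) :=
  fun _ _ hε _ => Or.imp_right fun ⟨g, h, hgh, hp⟩ =>
    ⟨g, h, hgh.trans (ENNReal.coe_le_coe.mpr hε), hp⟩

theorem respects_bandRel (hs : ∀ g h, s g * s h = s g)
    (hs_le : ∀ g h, edist (s g) (s h) ≤ edist g h) :
    Respects (fun ε => bandRel hs ε) (MonoidHom.id N) := by
  rintro ε _ (rfl | ⟨g, h, hgh, rfl⟩)
  · exact (edist_self (1 : N)).trans_le zero_le
  · exact (hs_le g h).trans hgh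

theorem edist_mul_mul_le (a b x y : N) : edist (a * x * b) (a * y * b) ≤ edist x y :=
  calc
    edist (a * x * b) (a * y * b) ≤ edist a a + edist x y + edist b b :=
      (N.edist_mul_le _ _ _ _).trans (add_le_add (N.edist_mul_le _ _ _ _) le_rfl)
    _ = edist x y := by rw [edist_self, edist_self, zero_add, add_zero]

/-- The hypotheses embed `G` in a subregular quotient of the discrete monoid `N`. The relations
needed to make this embedding nonexpanding form submonoids because the values of `s` are a band. -/
theorem IsSubregularProjective.isDiscrete_of_band (hG : IsSubregularProjective G)
    (hs : ∀ g h, s g * s h = s g) (hs_le : ∀ g h, edist (s g) (s h) ≤ edist g h) {φ : G →* N}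
    (hφ : Function.Injective φ) {a b : N} (hφs : ∀ g, φ g = a * s g * b) : IsDiscrete G := by
  let R : ℝ≥0 → Set (N × N) := fun ε => bandRel hs ε
  let p : N →* presented R := toPresented R
  have hp : Function.Injective p := fun x y =>
    eq_of_edist_le (f := p) (g := MonoidHom.id N) ((respects_bandRel hs hs_le).edist_le x y)
  have hps (g h : G) : edist (p (s g)) (p (s h)) ≤ edist g h :=
    edist_toPresented_le fun _ hε => .inr ⟨g, h, hε, rfl⟩
  let i : G ⟶ presented R := Hom.mk (p.comp φ) fun g h => by
    simp only [MonoidHom.comp_apply, hφs, map_mul]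
    exact (edist_mul_mul_le _ _ _ _).trans (hps g h)
  obtain ⟨k, hk⟩ := hG _ (isSubregularEpi_toPresented (monotone_bandRel hs)) i
  have hk_inj : Function.Injective k.toHom := fun x y hxy =>
    hφ (hp ((hom_congr hk x).symm.trans ((congrArg p hxy).trans (hom_congr hk y))))
  exact fun x y hxy => top_le_iff.mp
    ((isDiscrete_discrete N (hk_inj.ne hxy)).ge.trans (k.nonexpanding x y))

end Band

section Endomorphisms

/-- The endomorphisms of an object of a metric-enriched category. -/
def endo {C : Type w} [Category.{u} C] [MetricEnriched C] (Z : C) : MonMet.{u} where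
  carrier := End Z
  metric := MetricEnriched.homMetric Z Z
  edist_mul_le x x' y y' :=
    (MetricEnriched.edist_comp_le y y' x x').trans_eq (add_comm _ _)

/-- Streams carry the sum of the distances of their terms. -/
instance {X : Type*} [EMetricSpace X] : EMetricSpace (Stream' X) where
  edist s t := ∑' n, edist (s.get n) (t.get n)
  edist_self s := by simp only [edist_self, tsum_zero]
  edist_comm s t := by simp only [edist_comm]
  edist_triangle s t r :=
    (ENNReal.tsum_le_tsum fun n => edist_triangle _ (t.get n) _).trans_eq ENNReal.tsum_add
  eq_of_edist_eq_zero h :=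
    Stream'.ext fun n => eq_of_edist_eq_zero (ENNReal.tsum_eq_zero.mp h n)

theorem edist_stream {X : Type*} [EMetricSpace X] (s t : Stream' X) :
    edist s t = edist s.head t.head + edist s.tail t.tail :=
  tsum_eq_zero_add' ENNReal.summable

theorem edist_cons {X : Type*} [EMetricSpace X] (x y : X) (s t : Stream' X) :
    edist (Stream'.cons x s) (Stream'.cons y t) = edist x y + edist s t :=
  edist_stream _ _

/-- The metric space of streams in `G`. -/
abbrev streams (G : MonMet.{u}) : Met.{u} :=
  Met.mk (Stream' G)

variable {G : MonMet.{u}}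

/-- The endomorphism of streams that replaces the head by `g`. -/
def setHead (g : G) : endo (streams G) :=
  Met.Hom.mk (fun s => Stream'.cons g (Stream'.tail s)) fun s t => by
    rw [edist_cons, edist_self, zero_add, edist_stream s t]
    exact le_add_self

/-- The endomorphism of streams that prepends `1`. -/
def consOne : endo (streams G) :=
  Met.Hom.mk (fun s => Stream'.cons 1 s) fun s t => by rw [edist_cons, edist_self, zero_add]

/-- The endomorphism of streams that multiplies the first two terms. -/
def mulHead : endo (streams G) :=
  Met.Hom.mk (fun s => Stream'.cons (Stream'.head s * Stream'.head (Stream'.tail s))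
      (Stream'.tail (Stream'.tail s))) fun s t => by
    rw [edist_cons, edist_stream s t, edist_stream (Stream'.tail s), ← add_assoc]
    exact add_le_add (G.edist_mul_le _ _ _ _) le_rfl

theorem setHead_mul_setHead (g h : G) : setHead g * setHead h = setHead g :=
  rfl

theorem edist_setHead_le (g h : G) : edist (setHead g) (setHead h) ≤ edist g h :=
  iSup_le fun s => (edist_cons _ _ _ _).trans_le (by rw [edist_self, add_zero])

/-- The action of `G` on streams by left multiplication of the head. -/
def mulLeftHead : G →* endo (streams G) where
  toFun g := mulHead * setHead g * consOne
  map_one' := Met.Hom.ext (funext fun s =>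
    (congrArg (Stream'.cons · (Stream'.tail s)) (one_mul _)).trans (Stream'.eta s))
  map_mul' g h := Met.Hom.ext (funext fun s =>
    congrArg (Stream'.cons · (Stream'.tail s)) (mul_assoc g h _))

theorem mulLeftHead_injective : Function.Injective (mulLeftHead (G := G)) := fun g h hgh => by
  have h_one : g * 1 = h * 1 :=
    congrArg (fun k : streams G ⟶ streams G => Stream'.head (k.toFun (Stream'.const 1))) hgh
  rwa [mul_one, mul_one] at h_one

end Endomorphisms

theorem isDiscrete_of_isSubregularProjective {G : MonMet.{u}} (hG : IsSubregularProjective G) :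
    IsDiscrete G :=
  IsSubregularProjective.isDiscrete_of_band hG setHead_mul_setHead edist_setHead_le
    mulLeftHead_injective fun _ => rfl

theorem exists_iso_words_of_isSubregularProjective {G : MonMet.{u}}
    (hG : IsSubregularProjective G) : ∃ A : Type u, Nonempty (G ≅ words A) := by
  have hG_discrete := isDiscrete_of_isSubregularProjective hG
  let p : FreeMonoid G →* G := FreeMonoid.lift id
  have hp : Function.Surjective p := fun x => ⟨FreeMonoid.of x, FreeMonoid.lift_eval_of _ x⟩
  obtain ⟨i, hi⟩ := hG _ (hG_discrete.isSubregularEpi_of_surjective hp) (𝟙 G)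
  have hpi : Function.LeftInverse p i.toHom := hom_congr hi
  have h_len := (isLength_freeMonoid G).comp_injective (i := i.toHom) hpi.injective
  have h_levi := (isEquidivisible_freeMonoid G).of_leftInverse i.toHom p hpi
  exact ⟨_, ⟨hG_discrete.isoOfMulEquiv (isDiscrete_words _) (h_len.freeMonoidEquiv h_levi).symm⟩⟩

end MonMet

end

end QuantAlg

open QuantAlg in
theorem mainTheorem11_general :
    (∀ (S : Signature.{v}) (E : Set (QuantEquation S)) (F : MonMet.{u} ⥤ Variety S E)
      [F.Full] [F.Faithful], IsEnrichedFunctor F →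
      ∀ L : Variety S E ⥤ MonMet.{u}, Nonempty (L ⊣ F) → ¬ IsEnrichedFunctor L) ∧
    (∀ G : MonMet.{u}, ¬ IsSubregularGenerator G) ∧
    (∀ G : MonMet.{u}, IsSubregularProjective G →
      ∃ A : Type u, Nonempty (G ≅ MonMet.words A)) ∧
    (∀ G : MonMet.{u}, (homFunctor G).IsRightAdjoint ∧
      (Nontrivial G → ∀ L : Met.{u} ⥤ MonMet.{u},
        Nonempty (L ⊣ homFunctor G) → ¬ IsEnrichedFunctor L)) :=
  ⟨fun _ E _ _ _ hF _ ⟨adj⟩ hL => MonMet.not_hasWeakApproxEqualizers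
      (.of_reflective hF hL adj (Variety.hasWeakApproxEqualizers E)),
    MonMet.not_isSubregularGenerator,
    fun _ => MonMet.exists_iso_words_of_isSubregularProjective,
    fun G => ⟨MonMet.isRightAdjoint_homFunctor G,
      fun _ _ ⟨adj⟩ => MonMet.not_isEnrichedFunctor_of_nontrivial adj⟩⟩

theorem mainTheorem11 :
    (∀ (S : QuantAlg.Signature.{u}) (E : Set (QuantAlg.QuantEquation S)),
      ¬ QuantAlg.EnrichedEquivalent QuantAlg.MonMet.{u} (QuantAlg.Variety S E)) ∧
    (∀ G : QuantAlg.MonMet.{u}, ¬ QuantAlg.IsSubvarietalGenerator G) ∧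
    (∀ G : QuantAlg.MonMet.{u}, QuantAlg.IsSubregularProjective G →
      ∃ A : Type u, Nonempty (G ≅ QuantAlg.MonMet.words A)) ∧
    (∀ A : Type u, Nonempty A →
      (QuantAlg.homFunctor (QuantAlg.MonMet.words A)).IsRightAdjoint ∧
      ∀ L : QuantAlg.Met.{u} ⥤ QuantAlg.MonMet.{u},
        Nonempty (L ⊣ QuantAlg.homFunctor (QuantAlg.MonMet.words A)) →
        ¬ QuantAlg.IsEnrichedFunctor L) :=
  have ⟨h_variety, h_generator, h_projective, h_adjoint⟩ := mainTheorem11_general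
  ⟨fun S E ⟨e, hF, hG⟩ => h_variety S E e.functor hF e.inverse ⟨e.symm.toAdjunction⟩ hG,
    fun G hG => h_generator G hG.generator,
    h_projective,
    fun A _ => ⟨(h_adjoint (.words A)).1,
      (h_adjoint (.words A)).2 (inferInstanceAs (Nontrivial (FreeMonoid A)))⟩⟩
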